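/- Let $K\in\mathbb R$, $N\in[1,\infty)$ and let $(X,d,\mathfrak m)$ be an $\mathrm{RCD}^*(K,N)$ space with $\operatorname{supp}\mathfrak m=X$. That is: $(X,d)$ is a complete separable metric space, $\mathfrak m$ is a Borel measure with full support that is finite on bounded sets, the reduced curvature-dimension condition $\mathrm{CD}^*(K,N)$ holds, and the Cheeger energy $\mathrm{Ch}$ is a quadratic form. Here: * $\mathrm{CD}^*(K,N)$ means that any two probability measures $\mu_0=\rho_0\mathfrak m$, $\mu_1=\rho_1\mathfrak m$ with bounded support are joined by an optimal dynamical plan $\pi$ (a Borel measure on $C([0,1],X)$ concentrated on constant speed minimizing geodesics, with $(e_0,e_1)_\#\pi$ an optimal coupling of $\mu_0,\mu_1$ for the cost $d^2$) such that for all $t\in(0,1)$ one has $(e_t)_\#\pi=\rho_t\mathfrak m\ll\mathfrak m$ and, for all $N'\ge N$, $$\int\rho_t^{1-1/N'}\,d\mathfrak m\ \ge\ \int\Big[\sigma^{(1-t)}_{K,N'}(d(\gamma_0,\gamma_1))\rho_0(\gamma_0)^{-1/N'}+\sigma^{(t)}_{K,N'}(d(\gamma_0,\gamma_1))\rho_1(\gamma_1)^{-1/N'}\Big]d\pi(\gamma)$$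 (with the convention $0^{0}=0$ on the left when $N'=1$), where $\sigma^{(t)}_{K,N}(\theta)=+\infty$ if $K\theta^2\ge N\pi^2$, $\;\sin(t\theta\sqrt{K/N})/\sin(\theta\sqrt{K/N})$ if $0<K\theta^2<N\pi^2$, $\;t$ if $K\theta^2=0$, and $\sinh(t\theta\sqrt{-K/N})/\sinh(\theta\sqrt{-K/N})$ if $K\theta^2<0$. * For $f\in L^2(X,\mathfrak m)$, $\mathrm{Ch}(f)=\inf\liminf_n\frac12\int|\nabla f_n|^2\,d\mathfrak m$, the infimum being over all sequences of bounded Lipschitz functions $f_n\in L^2(X,\mathfrak m)$ with $f_n\to f$ in $L^2$, and $|\nabla f_n|$ being the local Lipschitz constant. * $H^{1,2}(X,d,\mathfrak m)=\{f\in L^2:\mathrm{Ch}(f)<\infty\}$ with norm $(\|f\|_{L^2}^2+2\,\mathrm{Ch}(f))^{1/2}$. For $U\subset X$ open, $H^{1,2}_0(U,d,\mathfrak m)$ is the closure in $H^{1,2}(X,d,\mathfrak m)$ of the Lipschitz functions with compact support in $U$, and $\hat H^{1,2}_0(U,d,\mathfrak m)$ is the set of $f\in H^{1,2}(X,d,\mathfrak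 m)$ with $f=0$ $\mathfrak m$-a.e. in $X\setminus U$. Let $B_R(x)$ denote the open ball. Then for all $x\in X$ and $R>0$ $$\hat H^{1,2}_0(B_R(x),d,\mathfrak m)=\bigcap_{\epsilon>0}H^{1,2}_0(B_{R+\epsilon}(x),d,\mathfrak m).$$ In addition, for every $x\in X$, the equality $\hat H^{1,2}_0(B_R(x),d,\mathfrak m)=H^{1,2}_0(B_R(x),d,\mathfrak m)$ holds for all $R>0$ with at most countably many exceptions. -/

import Mathlib

open MeasureTheory Filter Topology Metric Set
open scoped ENNReal NNReal unitInterval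

noncomputable section

namespace RCDSpace

/-! ### Optimal transport and the reduced curvature-dimension condition -/

/-- The distortion coefficient `σ_{K,N}^{(t)}(θ)` with values in `[0, ∞]`. -/
def distortion (K N t θ : ℝ) : ℝ≥0∞ :=
  open Classical in
  if N * Real.pi ^ 2 ≤ K * θ ^ 2 then ⊤
  else if 0 < K * θ ^ 2 then
    ENNReal.ofReal (Real.sin (t * θ * √(K / N)) / Real.sin (θ * √(K / N)))
  else if K * θ ^ 2 = 0 then ENNReal.ofReal t
  else ENNReal.ofReal (Real.sinh (t * θ * √(-K / N)) / Real.sinh (θ * √(-K / N)))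

section Transport

variable {X : Type*} [MetricSpace X] [MeasurableSpace X]

/-- The space of continuous curves `[0,1] → X` (uniform convergence) carries its Borel
σ-algebra. -/
instance pathMeasurableSpace : MeasurableSpace C(I, X) := borel _

instance pathBorelSpace : BorelSpace C(I, X) := ⟨rfl⟩

/-- `γ` is a (constant speed, minimizing) geodesic parametrized on `[0,1]`. -/
def IsGeodesic (γ : C(I, X)) : Prop :=
  ∀ s t : I, dist (γ s) (γ t) = |(s : ℝ) - t| * dist (γ 0) (γ 1)

/-- `q` is a coupling (transport plan) of `μ` and `ν`. -/
def IsCoupling (q : Measure (X × X)) (μ ν : Measure X) : Prop :=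
  q.map Prod.fst = μ ∧ q.map Prod.snd = ν

/-- `Π` is an optimal dynamical plan from `μ` to `ν`: a measure concentrated on geodesics whose
endpoint marginal is a coupling of `μ` and `ν` that minimizes the quadratic transport cost. -/
structure IsOptimalDynamicalPlan (P : Measure C(I, X)) (μ ν : Measure X) : Prop where
  geodesic : ∀ᵐ γ ∂P, IsGeodesic γ
  start : P.map (fun γ => γ 0) = μ
  finish : P.map (fun γ => γ 1) = ν
  optimal : ∀ q : Measure (X × X), IsCoupling q μ ν →
    ∫⁻ γ, edist (γ 0) (γ 1) ^ 2 ∂P ≤ ∫⁻ p, edist p.1 p.2 ^ 2 ∂q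

/-- `μ` is a Borel probability measure with bounded support which is absolutely continuous with
respect to the reference measure `m`. -/
structure IsBoundedAC (m μ : Measure X) : Prop where
  prob : IsProbabilityMeasure μ
  bounded : ∃ B : Set X, Bornology.IsBounded B ∧ μ Bᶜ = 0
  ac : μ ≪ m

/-- The reduced curvature-dimension condition `CD*(K,N)`: any two absolutely continuous
probability measures `μ₀ = ρ₀ m`, `μ₁ = ρ₁ m` with bounded support are joined by an optimal
dynamical plan `P` whose interpolations `μ_t = (e_t)_# P = ρ_t m` satisfy, for all `t ∈ (0,1)` and
all `N' ≥ N`, with the Rényi entropy `S_{N'}(ρ m) = - ∫ ρ ^ (1 - 1 / N') dm`,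
`S_{N'}(μ_t) ≤ - ∫ σ^{(1-t)}(d(γ₀,γ₁)) ρ₀(γ₀) ^ (-1/N') + σ^{(t)}(d(γ₀,γ₁)) ρ₁(γ₁) ^ (-1/N') dP(γ)`.
Here `- S_{N'}(ρ m)` is written as the integral of `ρ ^ (-1 / N')` against `ρ m`. The inequality is
trivial at the endpoints `t = 0, 1`. -/
def CDStar (K N : ℝ) (m : Measure X) : Prop :=
  ∀ μ₀ μ₁ : Measure X, IsBoundedAC m μ₀ → IsBoundedAC m μ₁ →
    ∃ P : Measure C(I, X), IsOptimalDynamicalPlan P μ₀ μ₁ ∧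
      ∀ t : I, 0 < t → t < 1 →
        P.map (fun γ => γ t) ≪ m ∧
        ∀ N' : ℝ, N ≤ N' →
          ∫⁻ γ, (distortion K N' (1 - t) (dist (γ 0) (γ 1)) * μ₀.rnDeriv m (γ 0) ^ (-1 / N') +
              distortion K N' t (dist (γ 0) (γ 1)) * μ₁.rnDeriv m (γ 1) ^ (-1 / N')) ∂P ≤
            ∫⁻ y, (P.map (fun γ => γ t)).rnDeriv m y ^ (-1 / N') ∂(P.map (fun γ => γ t))

end Transport

/-! ### Cheeger energy and Sobolev spaces -/

section Sobolev

variable {X : Type*} [MetricSpace X] [MeasurableSpace X]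

/-- The slope (local Lipschitz constant) `|∇f|(x) = limsup_{y → x} |f y - f x| / d(y,x)`, equal to
`0` at isolated points. -/
def localSlope (f : X → ℝ) (x : X) : ℝ≥0∞ :=
  limsup (fun y => edist (f y) (f x) / edist y x) (𝓝[≠] x)

/-- Bounded Lipschitz functions `LIP_b(X,d)`. -/
def IsLipBounded (f : X → ℝ) : Prop :=
  (∃ L : ℝ≥0, LipschitzWith L f) ∧ ∃ C : ℝ, ∀ x, |f x| ≤ C

/-- Lipschitz functions with compact support contained in `U`, `LIP_c(U,d)`. -/
def IsLipCompact (U : Set X) (f : X → ℝ) : Prop :=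
  (∃ L : ℝ≥0, LipschitzWith L f) ∧ HasCompactSupport f ∧ tsupport f ⊆ U

/-- The Cheeger energy: the infimum of `liminf ½ ∫ |∇ u_n|² dm` over all sequences `u_n` in
`LIP_b(X,d) ∩ L²(X,m)` converging to `f` in `L²(X,m)`. -/
def cheeger (m : Measure X) (f : Lp ℝ 2 m) : ℝ≥0∞ :=
  ⨅ u : {u : ℕ → X → ℝ // (∀ n, IsLipBounded (u n) ∧ MemLp (u n) 2 m) ∧
      Tendsto (fun n => eLpNorm (u n - ⇑f) 2 m) atTop (𝓝 0)},
    liminf (fun n => (1 / 2) * ∫⁻ x, localSlope (u.1 n) x ^ 2 ∂m) atTop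

/-- Infinitesimal Hilbertianity: the Cheeger energy is a quadratic form. -/
def InfinitesimallyHilbertian (m : Measure X) : Prop :=
  ∀ f g : Lp ℝ 2 m,
    cheeger m (f + g) + cheeger m (f - g) = 2 * cheeger m f + 2 * cheeger m g

/-- The Sobolev space `H^{1,2}(X,d,m)`, as a subset of `L²(X,m)`. -/
def H12 (m : Measure X) : Set (Lp ℝ 2 m) := {f | cheeger m f < ⊤}

/-- The Sobolev norm `(‖f‖²_{L²} + 2 Ch(f))^{1/2}`, with value `∞` outside `H^{1,2}(X,d,m)`. -/
def sobolevNorm (m : Measure X) (f : Lp ℝ 2 m) : ℝ≥0∞ :=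
  (‖f‖ₑ ^ 2 + 2 * cheeger m f) ^ (1 / 2 : ℝ)

/-- `H^{1,2}_0(U,d,m)`: the closure of `LIP_c(U,d)` in `H^{1,2}(X,d,m)` for the Sobolev norm. -/
def H12Zero (m : Measure X) (U : Set X) : Set (Lp ℝ 2 m) :=
  {f | f ∈ H12 m ∧ ∀ ε : ℝ≥0∞, 0 < ε →
    ∃ g : Lp ℝ 2 m, (∃ u : X → ℝ, IsLipCompact U u ∧ ⇑g =ᵐ[m] u) ∧ sobolevNorm m (f - g) < ε}

/-- `Ĥ^{1,2}_0(U,d,m)`: the functions in `H^{1,2}(X,d,m)` that vanish `m`-a.e. in `X \ U`. -/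
def H12Hat (m : Measure X) (U : Set X) : Set (Lp ℝ 2 m) :=
  {f | f ∈ H12 m ∧ ∀ᵐ y ∂m, y ∉ U → f y = 0}

end Sobolev

/-- `(X,d,m)` is an `RCD*(K,N)` space: `m` has full support and is finite on bounded sets, the
reduced curvature-dimension condition `CD*(K,N)` holds and the Cheeger energy is quadratic.
(Completeness and separability of `(X,d)` are instance arguments of statements about it.) -/
structure IsRCDStar {X : Type*} [MetricSpace X] [MeasurableSpace X]
    (K N : ℝ) (m : Measure X) : Prop where
  full_support : ∀ (x : X) (r : ℝ), 0 < r → 0 < m (ball x r)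
  finite_ball : ∀ (x : X) (r : ℝ), m (ball x r) < ⊤
  cdStar : CDStar K N m
  hilbertian : InfinitesimallyHilbertian m

end RCDSpace

end

/-! Geometry enters only through a Brunn–Minkowski inequality, got by testing `CDStar` on normalized
restrictions of `m` (`CDStar.brunn_minkowski`). It bounds the measure of small balls from below,
uniformly on bounded sets, so the space is proper (`IsRCDStar.properSpace`). It also makes spheres
null (`IsRCDStar.measure_sphere`): contracting a sphere of positive measure towards its centre would
yield infinitely many disjoint spheres of measure bounded below inside one ball.

Analysis rests on `mem_H12Zero_of_forall_exists`. By the parallelogram identity, `L²` approximation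
by compactly supported Lipschitz functions of bounded energy already gives Sobolev approximation.

If `f` vanishes off `B_R`, cutting off Lipschitz approximants of `f` costs bounded energy, and
properness makes the supports compact; so `f` lies in every `H12Zero` of a larger ball. Conversely,
a function in all these spaces vanishes off the closed ball, hence off the open one since the sphere
is null.

For the countable exceptional set, `penalizedEnergy` is monotone in the radius, so for each weight
`l` and each `h` in a countable dense set it has countably many discontinuities. At any other radius
the bounds valid for larger balls pass to the limit and yield approximants of bounded energy
supported in `B_R` itself. -/

namespace RCDSpace

/-! ### Bounds on the distortion coefficients -/

lemma sinh_le_mul_cosh {a : ℝ} (ha : 0 ≤ a) : Real.sinh a ≤ a * Real.cosh a := by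
  have h := Convex.image_sub_le_mul_sub_of_deriv_le (convex_Icc 0 a) (f := Real.sinh)
    Real.continuous_sinh.continuousOn Real.differentiable_sinh.differentiableOn
    (C := Real.cosh a) (fun x hx => by
      rw [interior_Icc] at hx
      rw [Real.deriv_sinh, Real.cosh_le_cosh, abs_of_pos hx.1, abs_of_nonneg ha]
      exact hx.2.le) 0 (left_mem_Icc.2 ha) a (right_mem_Icc.2 ha) ha
  simp only [Real.sinh_zero, sub_zero] at h
  linarith

lemma mul_sin_le_sin_mul {s a : ℝ} (hs : 0 ≤ s) (hs1 : s ≤ 1) (ha : 0 ≤ a) (ha' : a ≤ Real.pi) :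
    s * Real.sin a ≤ Real.sin (s * a) := by
  have h := strictConcaveOn_sin_Icc.concaveOn.2 (x := a) ⟨ha, ha'⟩ (y := 0)
    ⟨le_rfl, Real.pi_pos.le⟩ hs (sub_nonneg.2 hs1) (by ring)
  simpa using h

/-- Concavity of `sin` gives the bound `s` when `K > 0`; for `K < 0`, compare `sinh (s a) ≥ s a`
with `sinh a ≤ a cosh a`. The real square root of a negative number is `0`, so `M = 1` when `K ≥ 0`.
-/
lemma distortion_lower_bound (K : ℝ) {N s₀ D : ℝ} (hN : 0 < N) (hs₀ : 0 < s₀) :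
    ∃ c : ℝ≥0∞, c ≠ 0 ∧ ∀ s θ : ℝ, s₀ ≤ s → s ≤ 1 → 0 ≤ θ → θ ≤ D →
      c ≤ distortion K N s θ := by
  set M := Real.cosh (D * √(-K / N)) with hM
  have hM1 : 1 ≤ M := Real.one_le_cosh _
  have hM0 : 0 < M := by linarith
  refine ⟨ENNReal.ofReal (s₀ / M), by simpa using div_pos hs₀ hM0, ?_⟩
  intro s θ hs hs1 hθ hθD
  have hs0 : 0 < s := hs₀.trans_le hs
  have hle : s₀ / M ≤ s := (div_le_self hs₀.le hM1).trans hs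
  unfold distortion
  split_ifs with h1 h2 h3
  · exact le_top
  · have hK : 0 < K := by
      by_contra hK
      nlinarith [sq_nonneg θ]
    have hθ0 : 0 < θ := by
      rcases hθ.eq_or_lt with h | h
      · rw [← h] at h2; simp at h2
      · exact h
    have hα0 : 0 < θ * √(K / N) := by positivity
    have hαπ : θ * √(K / N) < Real.pi := by
      apply lt_of_pow_lt_pow_left₀ 2 Real.pi_pos.le
      rw [mul_pow, Real.sq_sqrt (by positivity), mul_div_assoc', div_lt_iff₀ hN]
      rw [not_le] at h1
      linarith
    apply ENNReal.ofReal_le_ofReal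
    refine hle.trans ?_
    rw [le_div_iff₀ (Real.sin_pos_of_pos_of_lt_pi hα0 hαπ), mul_assoc]
    exact mul_sin_le_sin_mul hs0.le hs1 hα0.le hαπ.le
  · exact ENNReal.ofReal_le_ofReal hle
  · have hK : K < 0 := by
      by_contra hK
      rw [not_lt] at hK
      have : 0 ≤ K * θ ^ 2 := by positivity
      exact h2 (lt_of_le_of_ne this (Ne.symm h3))
    have hθ0 : 0 < θ := by
      rcases hθ.eq_or_lt with h | h
      · rw [← h] at h3; simp at h3
      · exact h
    have hq : 0 < -K / N := div_pos (by linarith) hN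
    have hα0 : 0 < θ * √(-K / N) := by positivity
    apply ENNReal.ofReal_le_ofReal
    rw [div_le_div_iff₀ hM0 (Real.sinh_pos_iff.2 hα0)]
    have e1 : Real.sinh (θ * √(-K / N)) ≤ θ * √(-K / N) * M := by
      refine (sinh_le_mul_cosh hα0.le).trans (mul_le_mul_of_nonneg_left ?_ hα0.le)
      rw [hM, Real.cosh_le_cosh, abs_of_pos hα0]
      exact (mul_le_mul_of_nonneg_right hθD (Real.sqrt_nonneg _)).trans (le_abs_self _)
    have e2 : s * θ * √(-K / N) ≤ Real.sinh (s * θ * √(-K / N)) :=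
      Real.self_le_sinh_iff.2 (by positivity)
    calc s₀ * Real.sinh (θ * √(-K / N)) ≤ s * (θ * √(-K / N) * M) :=
          mul_le_mul hs e1 (Real.sinh_pos_iff.2 hα0).le hs0.le
      _ = s * θ * √(-K / N) * M := by ring
      _ ≤ _ := mul_le_mul_of_nonneg_right e2 hM0.le

/-! ### A Brunn–Minkowski inequality and its consequences -/

open ProbabilityTheory in
lemma ae_mem_cond {X : Type*} [MeasurableSpace X] {m : Measure X} {A : Set X}
    (hA : MeasurableSet A) : ∀ᵐ y ∂(m[|A]), y ∈ A := by
  rw [ae_iff]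
  change (m[|A]) Aᶜ = 0
  simp [ProbabilityTheory.cond, hA]

/-- With `ρ` the density of `ν`, Hölder reduces to `∫ ρ⁻¹ dν = ∫_C ρ ρ⁻¹ dm`, whose integrand is at
most `1`. -/
lemma lintegral_rnDeriv_rpow_le {X : Type*} [MeasurableSpace X] {m ν : Measure X}
    [SigmaFinite m] [IsProbabilityMeasure ν] (hν : ν ≪ m) {C : Set X} (hC : MeasurableSet C)
    (hνC : ν Cᶜ = 0) {p : ℝ} (hp : 1 < p) :
    ∫⁻ y, ν.rnDeriv m y ^ (-1 / p) ∂ν ≤ m C ^ (1 / p) := by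
  have hp0 : 0 < p := by linarith
  have hmeas : Measurable fun y => (ν.rnDeriv m y)⁻¹ := (Measure.measurable_rnDeriv ν m).inv
  have h1 : ∫⁻ y, ν.rnDeriv m y ^ (-1 / p) ∂ν ≤ (∫⁻ y, (ν.rnDeriv m y)⁻¹ ∂ν) ^ (1 / p) := by
    have h := ENNReal.lintegral_mul_le_Lp_mul_Lq ν (Real.HolderConjugate.conjExponent hp)
      (f := fun y => ν.rnDeriv m y ^ (-1 / p)) (g := fun _ => 1)
      ((Measure.measurable_rnDeriv ν m).pow_const _).aemeasurable aemeasurable_const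
    simp only [Pi.mul_apply, mul_one, ENNReal.one_rpow, lintegral_const, measure_univ] at h
    refine h.trans (le_of_eq ?_)
    congr 1
    refine lintegral_congr fun y => ?_
    rw [← ENNReal.rpow_mul, div_mul_cancel₀ _ hp0.ne', ENNReal.rpow_neg_one]
  refine h1.trans (ENNReal.rpow_le_rpow ?_ (by positivity))
  have h2 : ν.restrict C = ν := Measure.restrict_eq_self_of_ae_mem (by
    rw [ae_iff]; exact hνC)
  calc ∫⁻ y, (ν.rnDeriv m y)⁻¹ ∂ν = ∫⁻ y in C, (ν.rnDeriv m y)⁻¹ ∂ν := by rw [h2]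
    _ = ∫⁻ y in C, ν.rnDeriv m y * (ν.rnDeriv m y)⁻¹ ∂m :=
        (setLIntegral_rnDeriv_mul hν hmeas.aemeasurable hC).symm
    _ ≤ ∫⁻ _ in C, 1 ∂m := lintegral_mono fun y => ENNReal.mul_inv_le_one _
    _ = m C := by simp

section Transport

variable {X : Type*} [MetricSpace X] [MeasurableSpace X]

open ProbabilityTheory in
lemma isBoundedAC_cond {m : Measure X} {A : Set X} (hA : MeasurableSet A)
    (hAb : Bornology.IsBounded A) (h0 : m A ≠ 0) (h1 : m A ≠ ⊤) : IsBoundedAC m (m[|A]) where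
  prob := cond_isProbabilityMeasure_of_finite h0 h1
  bounded := ⟨A, hAb, by simp [ProbabilityTheory.cond, hA]⟩
  ac := cond_absolutelyContinuous

open ProbabilityTheory in
lemma rnDeriv_cond_ae_eq {X : Type*} [MeasurableSpace X] {m : Measure X} [SigmaFinite m]
    {A : Set X} (hA : MeasurableSet A) (h0 : m A ≠ 0) (h1 : m A ≠ ⊤) : ∀ᵐ y ∂(m[|A]), (m[|A]).rnDeriv m y = (m A)⁻¹ := by
  have : IsFiniteMeasure (m.restrict A) := ⟨by simpa using h1.lt_top⟩
  have e1 : (m[|A]).rnDeriv m =ᵐ[m] (m A)⁻¹ • (m.restrict A).rnDeriv m := by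
    rw [ProbabilityTheory.cond]
    exact Measure.rnDeriv_smul_left_of_ne_top _ _ (ENNReal.inv_ne_top.2 h0)
  have e2 := Measure.rnDeriv_restrict_self m hA
  have hac : m[|A] ≪ m := cond_absolutelyContinuous
  have hmem : ∀ᵐ y ∂(m[|A]), y ∈ A :=
    ae_mem_cond hA
  filter_upwards [hac.ae_le e1, hac.ae_le e2, hmem] with y h1 h2 h3
  rw [h1, Pi.smul_apply, h2, indicator_of_mem h3]
  simp

variable [BorelSpace X]

open ProbabilityTheory in
/-- If every geodesic from `A` to `B` is in `C` at time `t`, then `C` has at least a definite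
portion of the mass of `A`. -/
theorem CDStar.brunn_minkowski {K N : ℝ} {m : Measure X} [SigmaFinite m] (h : CDStar K N m)
    {p : ℝ} (hp : 1 < p) (hNp : N ≤ p) {A B C : Set X} (hA : MeasurableSet A)
    (hB : MeasurableSet B) (hC : MeasurableSet C) (hAb : Bornology.IsBounded A)
    (hBb : Bornology.IsBounded B) (hA0 : m A ≠ 0) (hA1 : m A ≠ ⊤) (hB0 : m B ≠ 0) (hB1 : m B ≠ ⊤)
    {t : I} (ht0 : 0 < t) (ht1 : t < 1) {c : ℝ≥0∞}
    (hc : ∀ a ∈ A, ∀ b ∈ B, c ≤ distortion K p (1 - t) (dist a b))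
    (hgeo : ∀ γ : C(I, X), IsGeodesic γ → γ 0 ∈ A → γ 1 ∈ B → γ t ∈ C) :
    c * m A ^ (1 / p) ≤ m C ^ (1 / p) := by
  have hA' := isBoundedAC_cond hA hAb hA0 hA1
  have hB' := isBoundedAC_cond hB hBb hB0 hB1
  obtain ⟨P, hP, hPt⟩ := h _ _ hA' hB'
  obtain ⟨hac, hineq⟩ := hPt t ht0 ht1
  specialize hineq p hNp
  have hev : ∀ s : I, Measurable fun γ : C(I, X) => γ s := fun s =>
    (continuous_eval_const s).measurable
  have hPprob : IsProbabilityMeasure P := by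
    refine ⟨?_⟩
    have := hA'.prob.measure_univ
    rw [← hP.start, Measure.map_apply (hev 0) MeasurableSet.univ] at this
    simpa using this
  have hprob : IsProbabilityMeasure (P.map fun γ => γ t) :=
    Measure.isProbabilityMeasure_map (hev t).aemeasurable
  have m0 : ∀ᵐ γ ∂P, γ 0 ∈ A ∧ (m[|A]).rnDeriv m (γ 0) = (m A)⁻¹ := by
    have : ∀ᵐ y ∂(m[|A]), y ∈ A ∧ (m[|A]).rnDeriv m y = (m A)⁻¹ := by
      exact (ae_mem_cond hA).and (rnDeriv_cond_ae_eq hA hA0 hA1)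
    rw [← hP.start] at this
    have := ae_of_ae_map (hev 0).aemeasurable this
    rwa [hP.start] at this
  have m1 : ∀ᵐ γ ∂P, γ 1 ∈ B := by
    have : ∀ᵐ y ∂(m[|B]), y ∈ B := by
      exact ae_mem_cond hB
    rw [← hP.finish] at this
    exact ae_of_ae_map (hev 1).aemeasurable this
  have hνC : (P.map fun γ => γ t) Cᶜ = 0 := by
    rw [Measure.map_apply (hev t) hC.compl]
    have : ∀ᵐ γ ∂P, γ t ∈ C := by
      filter_upwards [m0, m1, hP.geodesic] with γ h0 h1 hg
      exact hgeo γ hg h0.1 h1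
    exact this
  have hR := lintegral_rnDeriv_rpow_le hac hC hνC hp
  refine le_trans ?_ (hineq.trans hR)
  have : c * m A ^ (1 / p) = ∫⁻ _, c * m A ^ (1 / p) ∂P := by simp
  rw [this]
  refine lintegral_mono_ae ?_
  -- The term coming from `B` is discarded; `ρ₀ = (m A)⁻¹` on `A` turns the other into `m A ^ (1 /
  -- p)`.
  filter_upwards [m0, m1] with γ h0 h1
  refine le_trans ?_ le_self_add
  rw [h0.2, ENNReal.inv_rpow, ← ENNReal.rpow_neg, neg_div, neg_neg]
  exact mul_le_mul_left (hc _ h0.1 _ h1) _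

end Transport

/-! ### Volume lower bounds, properness and null spheres. -/

section Geometry

variable {X : Type*} [MetricSpace X]

lemma IsGeodesic.dist_start {γ : C(I, X)} (h : IsGeodesic γ) (t : I) :
    dist (γ t) (γ 0) = t * dist (γ 0) (γ 1) := by
  rw [h t 0]
  simp [abs_of_nonneg t.2.1]

lemma IsGeodesic.dist_finish {γ : C(I, X)} (h : IsGeodesic γ) (t : I) :
    dist (γ t) (γ 1) = (1 - t) * dist (γ 0) (γ 1) := by
  rw [h t 1, abs_sub_comm]
  simp [abs_of_nonneg (sub_nonneg.2 t.2.2)]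

variable [MeasurableSpace X] {m : Measure X} {K N : ℝ}

lemma IsRCDStar.isLocallyFiniteMeasure (hX : IsRCDStar K N m) : IsLocallyFiniteMeasure m :=
  ⟨fun x => ⟨ball x 1, ball_mem_nhds x one_pos, hX.finite_ball x 1⟩⟩

variable [TopologicalSpace.SeparableSpace X]

lemma IsRCDStar.sigmaFinite (hX : IsRCDStar K N m) : SigmaFinite m := by
  have := UniformSpace.secondCountable_of_separable X
  have := hX.isLocallyFiniteMeasure
  infer_instance

variable [BorelSpace X]

/-- Transport the fixed ball `ball x 1` almost all the way to `ball z (r / 2)`: the remaining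
distance is at most `s * D ≤ r / 4`, so the mass ends up in `ball z r`. -/
lemma IsRCDStar.exists_forall_le_measure_ball (hN : 1 ≤ N) (hX : IsRCDStar K N m) (x : X) (R : ℝ)
    {r : ℝ} (hr : 0 < r) :
    ∃ c : ℝ≥0∞, 0 < c ∧ ∀ z ∈ closedBall x R, c ≤ m (ball z r) := by
  have := hX.sigmaFinite
  rcases lt_or_ge R 0 with hR | hR
  · exact ⟨1, one_pos, by simp [closedBall_eq_empty.2 hR]⟩
  -- Dimension `N + 1` instead of `N` keeps the Hölder exponent above `1` even when `N = 1`.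
  have hp : 1 < N + 1 := by linarith
  set D := R + 1 + r / 2 with hD
  have hD0 : 0 < D := by positivity
  set s := min (1 / 2) (r / (4 * D)) with hs
  have hs0 : 0 < s := by positivity
  have hs1 : s ≤ 1 / 2 := min_le_left _ _
  have hsD : s * D ≤ r / 4 := by
    have : s ≤ r / (4 * D) := min_le_right _ _
    rw [le_div_iff₀ (by positivity)] at this
    linarith
  obtain ⟨c, hc0, hc⟩ := distortion_lower_bound K (N := N + 1) (s₀ := s) (D := D) (by linarith) hs0
  have hA0 := hX.full_support x 1 one_pos
  have hA1 := hX.finite_ball x 1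
  have hp' : 0 < 1 / (N + 1) := by positivity
  refine ⟨(c * m (ball x 1) ^ (1 / (N + 1))) ^ (N + 1), ?_, fun z hz => ?_⟩
  · refine ENNReal.rpow_pos_of_nonneg ?_ (by linarith)
    exact ENNReal.mul_pos hc0 (ENNReal.rpow_pos hA0 hA1.ne).ne'
  · have key := hX.cdStar.brunn_minkowski hp (by linarith) (A := ball x 1) (B := ball z (r / 2))
      (C := ball z r) (t := ⟨1 - s, by linarith, by linarith⟩) (c := c) measurableSet_ball
      measurableSet_ball measurableSet_ball isBounded_ball isBounded_ball hA0.ne' hA1.ne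
      (hX.full_support z _ (by positivity)).ne' (hX.finite_ball z _).ne
      (Subtype.mk_lt_mk.2 (by simp; linarith)) (Subtype.mk_lt_mk.2 (by simp; linarith)) ?_ ?_
    · have := ENNReal.rpow_le_rpow key (z := N + 1) (by linarith)
      rwa [← ENNReal.rpow_mul (m (ball z r)), one_div_mul_cancel (by linarith),
        ENNReal.rpow_one] at this
    · intro a ha b hb
      rw [mem_ball] at ha hb
      rw [mem_closedBall] at hz
      refine hc _ _ (by simp) (by simp; linarith) dist_nonneg ?_
      have h1 := dist_triangle4 a x z b
      rw [dist_comm x z, dist_comm z b] at h1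
      linarith
    · intro γ hγ h0 h1
      rw [mem_ball] at h0 h1 ⊢
      rw [mem_closedBall] at hz
      have h2 := hγ.dist_finish ⟨1 - s, by linarith, by linarith⟩
      have h3 := dist_triangle4 (γ 0) x z (γ 1)
      rw [dist_comm x z, dist_comm z (γ 1)] at h3
      have h4 := dist_triangle (γ ⟨1 - s, by linarith, by linarith⟩) (γ 1) z
      have h5 : s * dist (γ 0) (γ 1) ≤ s * D := mul_le_mul_of_nonneg_left (by linarith) hs0.le
      simp only [sub_sub_cancel] at h2
      linarith

theorem IsRCDStar.properSpace [CompleteSpace X] (hN : 1 ≤ N) (hX : IsRCDStar K N m) :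
    ProperSpace X := by
  refine ⟨fun x R => ?_⟩
  refine isCompact_iff_totallyBounded_isComplete.2 ⟨?_, isClosed_closedBall.isComplete⟩
  by_contra hcon
  rw [Metric.totallyBounded_iff] at hcon
  push Not at hcon
  obtain ⟨ε, hε, hcov⟩ := hcon
  obtain ⟨c, hc0, hc⟩ := hX.exists_forall_le_measure_ball hN x R (half_pos hε)
  -- An infinite `ε`-separated sequence gives disjoint balls of measure at least `c` inside a ball
  -- of finite measure.
  obtain ⟨f, hfR, hf⟩ := exists_seq_of_forall_finset_exists (· ∈ closedBall x R)
    (fun y z => ε ≤ dist z y) (fun s _ => by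
      obtain ⟨y, hy, hy'⟩ := Set.not_subset.1 (hcov s s.finite_toSet)
      refine ⟨y, hy, fun z hz => ?_⟩
      simp only [mem_iUnion, not_exists, mem_ball, not_lt] at hy'
      exact hy' z hz)
  have hsep : ∀ i j, i ≠ j → ε ≤ dist (f i) (f j) := by
    intro i j hij
    rcases hij.lt_or_gt with h | h
    · rw [dist_comm]; exact hf _ _ h
    · exact hf _ _ h
  have hfin := Measure.finite_const_le_meas_of_disjoint_iUnion m hc0
    (As := fun n => ball (f n) (ε / 2)) (fun _ => measurableSet_ball)
    (fun i j hij => ball_disjoint_ball (by linarith [hsep i j hij])) (by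
      refine ((measure_mono ?_).trans_lt (hX.finite_ball x (R + ε))).ne
      refine iUnion_subset fun n => ball_subset_ball' ?_
      have := mem_closedBall.1 (hfR n)
      linarith)
  exact Set.infinite_univ (hfin.subset fun n _ => hc _ (hfR n))

lemma IsRCDStar.exists_le_measure_sphere (hN : 1 ≤ N) (hX : IsRCDStar K N m) (x : X) {R : ℝ}
    (hR : 0 < R) (h0 : m (sphere x R) ≠ 0) :
    ∃ c : ℝ≥0∞, 0 < c ∧ ∀ t : ℝ, 0 < t → t ≤ 1 / 2 → c ≤ m (sphere x ((1 - t) * R)) := by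
  have := hX.sigmaFinite
  have hp : 1 < N + 1 := by linarith
  obtain ⟨c, hc0, hc⟩ := distortion_lower_bound K (N := N + 1) (s₀ := 1 / 2) (D := R + 1)
    (by linarith) (by norm_num)
  have hA1 : m (sphere x R) ≠ ⊤ :=
    ((measure_mono fun y hy => by
      rw [mem_sphere] at hy; rw [mem_ball]; linarith).trans_lt (hX.finite_ball x (R + 1))).ne
  refine ⟨(c * m (sphere x R) ^ (1 / (N + 1))) ^ (N + 1), ?_, fun t ht ht2 => ?_⟩
  · refine ENNReal.rpow_pos_of_nonneg ?_ (by linarith)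
    exact ENNReal.mul_pos hc0 (ENNReal.rpow_pos (pos_iff_ne_zero.2 h0) hA1).ne'
  -- The centre may be a null set, so the target is `ball x δ`. Intermediate points then lie in an
  -- annulus, with margins `δ` inside and `2δ` outside from the triangle inequality; the annuli
  -- shrink to the sphere.
  set A : ℕ → Set X := fun n =>
    {y | (1 - t) * R - 1 / ((n : ℝ) + 1) ≤ dist y x ∧ dist y x ≤ (1 - t) * R + 2 / ((n : ℝ) + 1)}
    with hA
  have hAm : ∀ n, MeasurableSet (A n) := fun n =>
    ((isClosed_le continuous_const (continuous_id.dist continuous_const)).inter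
      (isClosed_le (continuous_id.dist continuous_const) continuous_const)).measurableSet
  have hanti : Antitone A := by
    intro i j hij y hy
    have h1 : 1 / ((j : ℝ) + 1) ≤ 1 / ((i : ℝ) + 1) := by gcongr
    have h2 : 2 / ((j : ℝ) + 1) ≤ 2 / ((i : ℝ) + 1) := by gcongr
    exact ⟨by linarith [hy.1], by linarith [hy.2]⟩
  have hfin : m (A 0) ≠ ⊤ := by
    refine ((measure_mono fun y hy => ?_).trans_lt (hX.finite_ball x (R + 3))).ne
    rw [mem_ball]
    have := hy.2
    simp only [Nat.cast_zero, zero_add, div_one] at this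
    nlinarith
  have hInter : ⋂ n, A n = sphere x ((1 - t) * R) := by
    ext y
    simp only [mem_iInter, mem_sphere]
    constructor
    · intro h
      have l1 := (tendsto_one_div_add_atTop_nhds_zero_nat (𝕜 := ℝ))
      have l2 := l1.const_mul 2
      refine le_antisymm ?_ ?_
      · have := ge_of_tendsto' (l2.const_add ((1 - t) * R)) (fun n => by
          rw [mul_one_div]; exact (h n).2)
        simpa using this
      · have := le_of_tendsto' (l1.const_sub ((1 - t) * R)) (fun n => (h n).1)
        simpa using this
    · intro h n
      refine ⟨?_, ?_⟩ <;> rw [h] <;> simp <;> positivity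
  have hlim := tendsto_measure_iInter_atTop (fun n => (hAm n).nullMeasurableSet (μ := m)) hanti
    ⟨0, hfin⟩
  rw [hInter] at hlim
  refine ge_of_tendsto' hlim fun n => ?_
  set δ : ℝ := 1 / ((n : ℝ) + 1) with hδ
  have hδ0 : 0 < δ := by positivity
  have hδ1 : δ ≤ 1 := by
    rw [hδ, div_le_one (by positivity)]; simp
  have hδ2 : 2 / ((n : ℝ) + 1) = 2 * δ := by rw [hδ]; ring
  have key := hX.cdStar.brunn_minkowski hp (by linarith) (A := sphere x R) (B := ball x δ)
    (C := A n) (t := ⟨t, by linarith, by linarith⟩) (c := c) isClosed_sphere.measurableSet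
    measurableSet_ball (hAm n) isBounded_sphere isBounded_ball h0 hA1
    (hX.full_support x _ hδ0).ne' (hX.finite_ball x _).ne
    (Subtype.mk_lt_mk.2 ht) (Subtype.mk_lt_mk.2 (by linarith)) ?_ ?_
  · have := ENNReal.rpow_le_rpow key (z := N + 1) (by linarith)
    rwa [← ENNReal.rpow_mul (m (A n)), one_div_mul_cancel (by linarith),
      ENNReal.rpow_one] at this
  · intro a ha b hb
    rw [mem_sphere] at ha
    rw [mem_ball] at hb
    refine hc _ _ (by linarith) (by linarith) dist_nonneg ?_
    have h1 := dist_triangle_right a b x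
    linarith
  · intro γ hγ h0 h1
    rw [mem_sphere] at h0
    rw [mem_ball] at h1
    have e0 := hγ.dist_start ⟨t, by linarith, by linarith⟩
    have e1 := hγ.dist_finish ⟨t, by linarith, by linarith⟩
    have h3 := dist_triangle_right (γ 0) (γ 1) x
    have h4 := dist_triangle (γ ⟨t, by linarith, by linarith⟩) (γ 1) x
    have h5 := dist_triangle_left (γ 0) x (γ ⟨t, by linarith, by linarith⟩)
    simp only at e0 e1
    have h6 : (1 - t) * dist (γ 0) (γ 1) ≤ (1 - t) * (R + δ) :=
      mul_le_mul_of_nonneg_left (by linarith) (by linarith)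
    have h7 : t * dist (γ 0) (γ 1) ≤ t * (R + δ) :=
      mul_le_mul_of_nonneg_left (by linarith) ht.le
    refine ⟨?_, ?_⟩
    · change (1 - t) * R - δ ≤ _
      nlinarith
    · rw [hδ2]
      nlinarith

theorem IsRCDStar.measure_sphere (hN : 1 ≤ N) (hX : IsRCDStar K N m) (x : X) {R : ℝ}
    (hR : 0 < R) : m (sphere x R) = 0 := by
  by_contra h0
  obtain ⟨c, hc0, hc⟩ := hX.exists_le_measure_sphere hN x hR h0
  have hfin := Measure.finite_const_le_meas_of_disjoint_iUnion m hc0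
    (As := fun n : ℕ => sphere x ((1 - 1 / ((n : ℝ) + 2)) * R))
    (fun _ => isClosed_sphere.measurableSet)
    (fun i j hij => Set.disjoint_left.2 fun y hi hj => hij (by
      rw [mem_sphere] at hi hj
      rw [hi] at hj
      have h1 := mul_right_cancel₀ hR.ne' hj
      have h2 : 1 / ((i : ℝ) + 2) = 1 / ((j : ℝ) + 2) := by linarith
      rw [one_div, one_div, inv_inj] at h2
      exact_mod_cast (add_right_cancel h2))) (by
      refine ((measure_mono ?_).trans_lt (hX.finite_ball x (R + 1))).ne
      refine iUnion_subset fun n y hy => ?_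
      rw [mem_sphere] at hy
      rw [mem_ball, hy]
      have : 0 < 1 / ((n : ℝ) + 2) := by positivity
      nlinarith)
  refine Set.infinite_univ (hfin.subset fun n _ => hc _ (by positivity) ?_)
  gcongr
  simp

end Geometry

lemma add_sq_le_four_mul (a b : ℝ≥0∞) : (a + b) ^ 2 ≤ 4 * (a ^ 2 + b ^ 2) := by
  have h : a + b ≤ 2 * max a b := by
    rw [two_mul]; exact add_le_add (le_max_left _ _) (le_max_right _ _)
  have h2 : max a b ^ 2 ≤ a ^ 2 + b ^ 2 := by
    rcases max_choice a b with h | h <;> rw [h]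
    · exact le_self_add
    · exact le_add_self
  calc (a + b) ^ 2 ≤ (2 * max a b) ^ 2 := by gcongr
    _ = 4 * max a b ^ 2 := by rw [mul_pow]; norm_num
    _ ≤ _ := by gcongr

/-! ### Slopes and cutoff functions -/

section Slope

variable {X : Type*} [MetricSpace X]

lemma localSlope_zero (x : X) : localSlope (0 : X → ℝ) x = 0 := by
  have : (fun y : X => edist ((0 : X → ℝ) y) ((0 : X → ℝ) x) / edist y x) = fun _ => ⊥ := by
    ext y; simp
  rw [localSlope, this, limsup_const_bot]
  rfl

/-- Leibniz rule in the form `χ z (v z - v y) + (χ z - χ y) v y`, where `v` is frozen at the base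
point. -/
lemma localSlope_mul_le {χ v : X → ℝ} {L : ℝ≥0} (hχ : LipschitzWith L χ) (hχ1 : ∀ y, ‖χ y‖ ≤ 1)
    (y : X) : localSlope (fun z => χ z * v z) y ≤ localSlope v y + L * ‖v y‖ₑ := by
  rcases eq_or_neBot (𝓝[≠] y) with hb | hb
  · simp [localSlope, hb]
  unfold localSlope
  rw [← limsup_add_const _ _ _ (by isBoundedDefault) (by isBoundedDefault)]
  refine limsup_le_limsup (Eventually.of_forall fun z => ?_)
  have hχz : ‖χ z‖ₑ ≤ 1 := by
    rw [← ofReal_norm]; simpa using hχ1 z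
  have e : edist (χ z * v z) (χ y * v y) ≤ edist (v z) (v y) + L * ‖v y‖ₑ * edist z y := by
    rw [edist_eq_enorm_sub, edist_eq_enorm_sub (v z),
      show χ z * v z - χ y * v y = χ z * (v z - v y) + (χ z - χ y) * v y by ring]
    refine (enorm_add_le _ _).trans (add_le_add ?_ ?_)
    · rw [enorm_mul]
      exact mul_le_of_le_one_left zero_le hχz
    · rw [enorm_mul, mul_right_comm (L : ℝ≥0∞), ← edist_eq_enorm_sub]
      exact mul_le_mul_left (hχ z y) _
  calc edist (χ z * v z) (χ y * v y) / edist z y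
      ≤ (edist (v z) (v y) + L * ‖v y‖ₑ * edist z y) / edist z y := by gcongr
    _ = edist (v z) (v y) / edist z y + L * ‖v y‖ₑ * edist z y / edist z y := ENNReal.add_div
    _ ≤ _ := add_le_add le_rfl (ENNReal.div_le_of_le_mul le_rfl)

lemma exists_cutoff (x : X) (R : ℝ) {ε : ℝ} (hε : 0 < ε) : ∃ χ : X → ℝ,
    (∃ L : ℝ≥0, LipschitzWith L χ) ∧ (∀ y, ‖χ y‖ ≤ 1) ∧ (∀ y ∈ ball x R, χ y = 1) ∧
      ∀ y ∉ closedBall x (R + ε), χ y = 0 := by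
  have h1 : LipschitzWith 1 fun y : X => (R + ε - dist y x) :=
    LipschitzWith.of_dist_le' (K := 1) (fun y z => by
      rw [Real.dist_eq, one_mul, sub_sub_sub_cancel_left, abs_sub_comm]
      exact abs_dist_sub_le _ _ _) |>.weaken (by simp)
  have h2 := (((lipschitzWith_smul ε⁻¹).comp h1).const_min 1).const_max 0
  refine ⟨fun y => max 0 (min 1 (ε⁻¹ * (R + ε - dist y x))), ⟨_, h2⟩, fun y => ?_, fun y hy => ?_, fun y hy => ?_⟩
  · rw [Real.norm_of_nonneg (le_max_left _ _)]
    exact max_le zero_le_one (min_le_left _ _)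
  · have : 1 ≤ ε⁻¹ * (R + ε - dist y x) := by
      rw [mem_ball] at hy
      rw [inv_mul_eq_div, le_div_iff₀ hε]
      linarith
    simp [min_eq_left this]
  · have : ε⁻¹ * (R + ε - dist y x) ≤ 0 := by
      rw [mem_closedBall, not_le] at hy
      exact mul_nonpos_of_nonneg_of_nonpos (by positivity) (by linarith)
    simp [min_eq_right (this.trans zero_le_one), this]

end Slope

section Cheeger

variable {X : Type*} [MetricSpace X] [MeasurableSpace X] {m : Measure X}

/-! ### Approximation and lower semicontinuity of the Cheeger energy -/

lemma cheeger_le_of_approx {f : Lp ℝ 2 m} {C : ℝ≥0∞}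
    (h : ∀ ε : ℝ≥0∞, 0 < ε → ∃ v : X → ℝ, IsLipBounded v ∧ MemLp v 2 m ∧
      eLpNorm (v - ⇑f) 2 m ≤ ε ∧ (1 / 2) * ∫⁻ x, localSlope v x ^ 2 ∂m ≤ C + ε) :
    cheeger m f ≤ C := by
  choose v hv1 hv2 hv3 hv4 using fun n : ℕ => h (n : ℝ≥0∞)⁻¹ (by simp)
  have hlim := ENNReal.tendsto_inv_nat_nhds_zero
  refine iInf_le_of_le ⟨v, fun n => ⟨hv1 n, hv2 n⟩,
    tendsto_of_tendsto_of_tendsto_of_le_of_le tendsto_const_nhds hlim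
      (fun _ => zero_le) hv3⟩ ?_
  have hlim2 : Tendsto (fun n : ℕ => C + (n : ℝ≥0∞)⁻¹) atTop (𝓝 C) := by
    simpa using hlim.const_add C
  rw [← hlim2.liminf_eq]
  exact liminf_le_liminf (Eventually.of_forall hv4)

lemma exists_approx_of_cheeger_le {f : Lp ℝ 2 m} {C : ℝ≥0∞} (hC : C ≠ ⊤) (h : cheeger m f ≤ C)
    {ε : ℝ≥0∞} (hε : 0 < ε) : ∃ v : X → ℝ, IsLipBounded v ∧ MemLp v 2 m ∧
      eLpNorm (v - ⇑f) 2 m ≤ ε ∧ (1 / 2) * ∫⁻ x, localSlope v x ^ 2 ∂m ≤ C + ε := by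
  have hlt : cheeger m f < C + ε := h.trans_lt (ENNReal.lt_add_right hC hε.ne')
  obtain ⟨⟨u, hu, hlim⟩, hlt⟩ := iInf_lt_iff.1 hlt
  obtain ⟨n, h1, h2⟩ := ((frequently_lt_of_liminf_lt (by isBoundedDefault) hlt).and_eventually
    (hlim.eventually_lt_const hε)).exists
  exact ⟨u n, (hu n).1, (hu n).2, h2.le, h1.le⟩

lemma cheeger_le_energy {f : Lp ℝ 2 m} {u : X → ℝ} (hu : IsLipBounded u) (hf : ⇑f =ᵐ[m] u) :
    cheeger m f ≤ (1 / 2) * ∫⁻ x, localSlope u x ^ 2 ∂m := by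
  refine cheeger_le_of_approx fun ε _ => ⟨u, hu, (Lp.memLp f).ae_eq hf, ?_, le_self_add⟩
  rw [eLpNorm_congr_ae (g := 0) (by filter_upwards [hf] with y hy; simp [hy])]
  simp

lemma Lp.enorm_sub_eq {X : Type*} [MeasurableSpace X] {m : Measure X} {f g : Lp ℝ 2 m} : ‖f - g‖ₑ = eLpNorm (⇑f - ⇑g) 2 m := by
  rw [Lp.enorm_def]
  exact eLpNorm_congr_ae (Lp.coeFn_sub f g)

/-- Lower semicontinuity in `L²`, by a diagonal choice of Lipschitz approximants. -/
lemma cheeger_le_of_forall_exists {f : Lp ℝ 2 m} {C : ℝ≥0∞}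
    (h : ∀ ε : ℝ≥0∞, 0 < ε → ∃ g : Lp ℝ 2 m, ‖g - f‖ₑ ≤ ε ∧ cheeger m g ≤ C) :
    cheeger m f ≤ C := by
  rcases eq_or_ne C ⊤ with rfl | hC
  · exact le_top
  refine cheeger_le_of_approx fun ε hε => ?_
  obtain ⟨g, hgf, hg⟩ := h (ε / 2) (ENNReal.half_pos hε.ne')
  obtain ⟨v, h1, h2, h3, h4⟩ := exists_approx_of_cheeger_le hC hg (ENNReal.half_pos hε.ne')
  refine ⟨v, h1, h2, ?_, h4.trans (by gcongr; exact ENNReal.half_le_self)⟩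
  rw [Lp.enorm_sub_eq] at hgf
  have : v - ⇑f = (v - ⇑g) + (⇑g - ⇑f) := by ring
  rw [this]
  refine (eLpNorm_add_le (h2.1.sub (Lp.aestronglyMeasurable g))
    ((Lp.aestronglyMeasurable g).sub (Lp.aestronglyMeasurable f)) (by norm_num)).trans ?_
  rw [← ENNReal.add_halves ε]
  exact add_le_add h3 hgf

lemma cheeger_zero : cheeger m (0 : Lp ℝ 2 m) = 0 := by
  have h : IsLipBounded (0 : X → ℝ) := ⟨⟨0, LipschitzWith.const 0⟩, 0, by simp⟩
  simpa [localSlope_zero] using cheeger_le_energy h (Lp.coeFn_zero ℝ 2 m)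

lemma InfinitesimallyHilbertian.cheeger_add_self (H : InfinitesimallyHilbertian m) (f : Lp ℝ 2 m) :
    cheeger m (f + f) = 4 * cheeger m f := by
  have := H f f
  rw [sub_self, cheeger_zero, add_zero, ← add_mul] at this
  rw [this]; norm_num

lemma InfinitesimallyHilbertian.cheeger_sub_le (H : InfinitesimallyHilbertian m)
    (f g : Lp ℝ 2 m) : cheeger m (f - g) ≤ 2 * cheeger m f + 2 * cheeger m g :=
  le_add_self.trans (H f g).le

/-! ### Classes of compactly supported Lipschitz functions -/

/-- The set of elements of `L²(X,m)` represented by functions in `LIP_c(U,d)`. -/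
def lipCompact (m : Measure X) (U : Set X) : Set (Lp ℝ 2 m) :=
  {g | ∃ u : X → ℝ, IsLipCompact U u ∧ ⇑g =ᵐ[m] u}

lemma lipCompact_mono {U V : Set X} (h : U ⊆ V) : lipCompact m U ⊆ lipCompact m V :=
  fun _ ⟨u, ⟨h1, h2, h3⟩, h4⟩ => ⟨u, ⟨h1, h2, h3.trans h⟩, h4⟩

lemma half_smul_add_mem_lipCompact {U : Set X} {f g : Lp ℝ 2 m} (hf : f ∈ lipCompact m U)
    (hg : g ∈ lipCompact m U) : (2⁻¹ : ℝ) • (f + g) ∈ lipCompact m U := by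
  obtain ⟨u, ⟨⟨L, hL⟩, hu2, hu3⟩, hu⟩ := hf
  obtain ⟨v, ⟨⟨M, hM⟩, hv2, hv3⟩, hv⟩ := hg
  have hsub : tsupport (fun y => 2⁻¹ * (u y + v y)) ⊆ tsupport u ∪ tsupport v := by
    refine (closure_mono fun y hy hy' => ?_).trans (tsupport_add u v)
    have : u y + v y = 0 := hy'
    exact hy (by simp [this])
  refine ⟨fun y => 2⁻¹ * (u y + v y), ⟨⟨_, (lipschitzWith_smul (2⁻¹ : ℝ)).comp (hL.add hM)⟩,
    (hu2.isCompact.union hv2.isCompact).of_isClosed_subset isClosed_closure hsub,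
    hsub.trans (union_subset hu3 hv3)⟩, ?_⟩
  filter_upwards [Lp.coeFn_smul (2⁻¹ : ℝ) (f + g), Lp.coeFn_add f g, hu, hv] with y h1 h2 h3 h4
  rw [h1, Pi.smul_apply, h2, Pi.add_apply, h3, h4, smul_eq_mul]

/-- A function that is approximated in `L²` by a family in `LIP_c(U,d)` of bounded Cheeger energy
belongs to `H^{1,2}_0(U,d,m)`. -/
theorem mem_H12Zero_of_forall_exists (H : InfinitesimallyHilbertian m) {U : Set X} {f : Lp ℝ 2 m}
    {C : ℝ≥0∞} (hC : C ≠ ⊤)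
    (h : ∀ ε : ℝ≥0∞, 0 < ε → ∃ g ∈ lipCompact m U, ‖g - f‖ₑ ≤ ε ∧ cheeger m g ≤ C) :
    f ∈ H12Zero m U := by
  refine ⟨(cheeger_le_of_forall_exists fun ε hε => ?_).trans_lt hC.lt_top, ?_⟩
  · obtain ⟨g, _, h1, h2⟩ := h ε hε
    exact ⟨g, h1, h2⟩
  -- `Q` is the lower limit of the energy along `lipCompact m U` as `g → f` in `L²`.
  set S : Set ℝ≥0∞ := {a | ∃ δ : ℝ≥0∞, 0 < δ ∧ ∀ g ∈ lipCompact m U, ‖g - f‖ₑ ≤ δ →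
    a ≤ cheeger m g}
  set Q := sSup S
  have hQC : Q ≤ C := sSup_le fun a ⟨δ, hδ, ha⟩ => by
    obtain ⟨g, h0, h1, h2⟩ := h δ hδ
    exact (ha g h0 h1).trans h2
  have hQt : Q ≠ ⊤ := ne_top_of_le_ne_top hC hQC
  have hlow : ∀ η : ℝ≥0∞, 0 < η → ∃ δ : ℝ≥0∞, 0 < δ ∧ ∀ g ∈ lipCompact m U, ‖g - f‖ₑ ≤ δ →
      Q ≤ cheeger m g + η := by
    intro η hη
    rcases eq_or_ne Q 0 with h0 | h0
    · exact ⟨1, one_pos, fun g _ _ => by rw [h0]; exact zero_le⟩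
    obtain ⟨a, ⟨δ, hδ, ha⟩, hlt⟩ := lt_sSup_iff.1 (ENNReal.sub_lt_self hQt h0 hη.ne')
    refine ⟨δ, hδ, fun g hg hgf => ?_⟩
    exact tsub_le_iff_right.1 (hlt.le.trans (ha g hg hgf))
  have hup : ∀ η : ℝ≥0∞, 0 < η → ∀ δ : ℝ≥0∞, 0 < δ → ∃ g ∈ lipCompact m U, ‖g - f‖ₑ ≤ δ ∧
      cheeger m g ≤ Q + η := by
    intro η hη δ hδ
    by_contra! hcon
    have : Q + η ≤ Q := le_sSup ⟨δ, hδ, fun g hg hgf => (hcon g hg hgf).le⟩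
    exact (ENNReal.lt_add_right hQt hη.ne').not_ge this
  have key : ∀ η : ℝ≥0∞, 0 < η → ∃ g ∈ lipCompact m U, ‖f - g‖ₑ ≤ η ∧
      cheeger m (f - g) ≤ 8 * η := by
    intro η hη
    obtain ⟨δ₀, hδ₀, hδ₀'⟩ := hlow η hη
    obtain ⟨g, hg, hgf, hgC⟩ := hup η hη (min δ₀ η) (lt_min hδ₀ hη)
    refine ⟨g, hg, ?_, cheeger_le_of_forall_exists fun δ hδ => ?_⟩
    · rw [← enorm_neg, neg_sub]; exact hgf.trans (min_le_right _ _)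
    obtain ⟨k, hk, hkf, hkC⟩ := hup η hη (min δ δ₀) (lt_min hδ hδ₀)
    refine ⟨k - g, by rw [sub_sub_sub_cancel_right]; exact hkf.trans (min_le_left _ _), ?_⟩
    -- The midpoint of two near-minimizers is again a competitor, so its energy is at least `Q - η`.
    -- The parallelogram identity then forces `Ch(k - g) ≤ 8η`, and letting `k → f` transfers this
    -- bound to `f - g`.
    set w := (2⁻¹ : ℝ) • (k + g) with hw
    have hww : w + w = k + g := by
      rw [hw, ← add_smul]; norm_num
    have hwf : ‖w - f‖ₑ ≤ δ₀ := by
      have e : w - f = (2⁻¹ : ℝ) • ((k - f) + (g - f)) := by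
        rw [hw]; module
      have e2 : ‖(2⁻¹ : ℝ)‖ₑ = 2⁻¹ := by
        rw [enorm_inv (by norm_num), Real.enorm_of_nonneg (by norm_num)]; simp
      rw [e, enorm_smul, e2]
      calc (2⁻¹ : ℝ≥0∞) * ‖(k - f) + (g - f)‖ₑ ≤ 2⁻¹ * (δ₀ + δ₀) := by
            gcongr
            exact (enorm_add_le _ _).trans (add_le_add (hkf.trans (min_le_right _ _))
              (hgf.trans (min_le_left _ _)))
        _ = δ₀ := by
            rw [← two_mul, ← mul_assoc, ENNReal.inv_mul_cancel (by norm_num) (by norm_num), one_mul]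
    have hQw := hδ₀' w (half_smul_add_mem_lipCompact hk hg) hwf
    have hpar := H k g
    rw [← hww, H.cheeger_add_self] at hpar
    rw [← ENNReal.add_le_add_iff_right (a := 4 * Q) (by finiteness)]
    calc cheeger m (k - g) + 4 * Q ≤ cheeger m (k - g) + 4 * (cheeger m w + η) := by gcongr
      _ = (4 * cheeger m w + cheeger m (k - g)) + 4 * η := by ring
      _ = 2 * cheeger m k + 2 * cheeger m g + 4 * η := by rw [hpar]
      _ ≤ 2 * (Q + η) + 2 * (Q + η) + 4 * η := by gcongr
      _ = 8 * η + 4 * Q := by ring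
  intro ε hε
  obtain ⟨e, he0, heε⟩ := ENNReal.lt_iff_exists_nnreal_btwn.1 hε
  have he0' : 0 < e := by exact_mod_cast he0
  -- For `η ≤ 1`, `η² + 16η ≤ 17η < 18η ≤ e²`.
  set η : ℝ≥0 := min 1 (e ^ 2 / 18) with hη
  have hη0 : 0 < η := by positivity
  obtain ⟨g, hg, h1, h2⟩ := key η (by exact_mod_cast hη0)
  refine ⟨g, hg, lt_trans ?_ heε⟩
  have h3 : η ^ 2 + 2 * (8 * η) < e ^ 2 := by
    have a1 : η ≤ 1 := min_le_left _ _
    have a2 : η ≤ e ^ 2 / 18 := min_le_right _ _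
    rw [← NNReal.coe_lt_coe]
    rw [← NNReal.coe_le_coe] at a1 a2
    rw [← NNReal.coe_lt_coe] at hη0
    push_cast at *
    nlinarith
  calc sobolevNorm m (f - g) ≤ ((η : ℝ≥0∞) ^ 2 + 2 * (8 * η)) ^ (1 / 2 : ℝ) := by
        unfold sobolevNorm; gcongr
    _ < ((e : ℝ≥0∞) ^ 2) ^ (1 / 2 : ℝ) :=
        ENNReal.rpow_lt_rpow (by exact_mod_cast h3) (by norm_num)
    _ = e := by rw [← ENNReal.rpow_natCast, ← ENNReal.rpow_mul]; norm_num

/-! ### Comparison of the two Sobolev spaces -/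

lemma lintegral_localSlope_mul_sq_le [OpensMeasurableSpace X] {χ v : X → ℝ} {L : ℝ≥0}
    (hχ : LipschitzWith L χ) (hχ1 : ∀ y, ‖χ y‖ ≤ 1) (hv : Continuous v) :
    ∫⁻ y, localSlope (fun z => χ z * v z) y ^ 2 ∂m ≤
      4 * (∫⁻ y, localSlope v y ^ 2 ∂m + L ^ 2 * eLpNorm v 2 m ^ 2) := by
  have h2 : eLpNorm v 2 m ^ 2 = ∫⁻ y, ‖v y‖ₑ ^ 2 ∂m := by
    have := eLpNorm_nnreal_pow_eq_lintegral (f := v) (μ := m) (p := 2) (by norm_num)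
    simpa using this
  rw [h2, ← lintegral_const_mul' _ _ (by finiteness), ← lintegral_add_right _ (by fun_prop),
    ← lintegral_const_mul' _ _ (by finiteness)]
  refine lintegral_mono fun y => ?_
  refine (pow_le_pow_left' (localSlope_mul_le hχ hχ1 y) 2).trans ?_
  rw [← mul_pow]
  exact add_sq_le_four_mul _ _

lemma H12Hat_ball_subset_H12Zero [ProperSpace X] [OpensMeasurableSpace X]
    (H : InfinitesimallyHilbertian m) (x : X) (R : ℝ) {ε : ℝ} (hε : 0 < ε) :
    H12Hat m (ball x R) ⊆ H12Zero m (ball x (R + ε)) := by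
  rintro f ⟨hf, hf0⟩
  have hf : cheeger m f < ⊤ := hf
  obtain ⟨χ, ⟨L, hL⟩, hχ1, hχR, hχ0⟩ := exists_cutoff x R (half_pos hε)
  refine mem_H12Zero_of_forall_exists H
    (C := (1 / 2) * (4 * (2 * (cheeger m f + 1) + L ^ 2 * (‖f‖ₑ + 1) ^ 2))) ?_ fun δ hδ => ?_
  · have : ‖f‖ₑ ≠ ⊤ := enorm_ne_top
    have := hf.ne
    exact ENNReal.mul_ne_top (by simp) (by finiteness)
  obtain ⟨v, ⟨⟨M, hM⟩, B, hB⟩, h2, h3, h4⟩ :=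
    exists_approx_of_cheeger_le hf.ne le_rfl (lt_min hδ one_pos)
  have hle : ∀ y, ‖χ y * v y‖ ≤ ‖v y‖ := fun y => by
    rw [norm_mul]
    exact mul_le_of_le_one_left (norm_nonneg _) (hχ1 y)
  have hmem : MemLp (fun y => χ y * v y) 2 m :=
    h2.of_le (hL.continuous.mul hM.continuous).aestronglyMeasurable (Eventually.of_forall hle)
  have hlip : IsLipBounded fun y => χ y * v y := by
    refine ⟨⟨_, LipschitzWith.of_dist_le' (K := M + B * L) fun y z => ?_⟩, B, fun y =>
      (hle y).trans (hB y)⟩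
    have e1 := hM.dist_le_mul y z
    have e2 := hL.dist_le_mul y z
    rw [Real.dist_eq] at e1 e2 ⊢
    rw [show χ y * v y - χ z * v z = χ y * (v y - v z) + v z * (χ y - χ z) by ring]
    refine (abs_add_le _ _).trans ?_
    rw [abs_mul, abs_mul, add_mul]
    refine add_le_add ((mul_le_of_le_one_left (abs_nonneg _) (hχ1 y)).trans e1) ?_
    rw [mul_assoc]
    exact mul_le_mul (hB z) e2 (abs_nonneg _) ((abs_nonneg _).trans (hB z))
  have hsupp : tsupport (fun y => χ y * v y) ⊆ closedBall x (R + ε / 2) := by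
    refine closure_minimal (fun y hy => ?_) isClosed_closedBall
    by_contra hy'
    exact hy (by simp [hχ0 y hy'])
  refine ⟨hmem.toLp _, ⟨_, ⟨hlip.1, (isCompact_closedBall x _).of_isClosed_subset
    isClosed_closure hsupp, hsupp.trans (closedBall_subset_ball (by linarith))⟩,
    hmem.coeFn_toLp⟩, ?_, ?_⟩
  · rw [Lp.enorm_sub_eq]
    refine le_trans (eLpNorm_mono_ae ?_) (h3.trans (min_le_left _ _))
    -- Cutting off does not increase the distance to `f`: `χ = 1` on the ball, and `f = 0` off it.
    filter_upwards [hmem.coeFn_toLp, hf0] with y h5 h6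
    simp only [Pi.sub_apply, h5]
    by_cases hy : y ∈ ball x R
    · rw [hχR y hy, one_mul]
    · rw [h6 hy, sub_zero, sub_zero]
      exact hle y
  · refine (cheeger_le_energy hlip hmem.coeFn_toLp).trans ?_
    gcongr
    refine (lintegral_localSlope_mul_sq_le hL hχ1 hM.continuous).trans ?_
    gcongr
    · calc ∫⁻ y, localSlope v y ^ 2 ∂m = 2 * ((1 / 2) * ∫⁻ y, localSlope v y ^ 2 ∂m) := by
            rw [← mul_assoc, one_div, ENNReal.mul_inv_cancel (by norm_num) (by norm_num), one_mul]
        _ ≤ 2 * (cheeger m f + 1) := by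
            gcongr
            exact h4.trans (by gcongr; exact min_le_right _ _)
    · have : v = ⇑f + (v - ⇑f) := by ring
      rw [this, Lp.enorm_def]
      refine (eLpNorm_add_le (Lp.aestronglyMeasurable f) (h2.1.sub (Lp.aestronglyMeasurable f))
        (by norm_num)).trans ?_
      gcongr
      exact h3.trans (min_le_right _ _)

lemma H12Zero_subset_H12Hat {U : Set X} (hU : MeasurableSet U) : H12Zero m U ⊆ H12Hat m U := by
  rintro f ⟨hf, hf'⟩
  refine ⟨hf, ?_⟩
  have h0 : eLpNorm f 2 (m.restrict Uᶜ) = 0 := by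
    by_contra hne
    obtain ⟨g, ⟨u, ⟨_, _, hu⟩, hgu⟩, hgε⟩ := hf' _ (pos_iff_ne_zero.2 hne)
    have hg0 : ∀ᵐ y ∂m.restrict Uᶜ, g y = 0 := by
      filter_upwards [ae_restrict_of_ae hgu, ae_restrict_mem hU.compl] with y h1 h2
      rw [h1]
      exact image_eq_zero_of_notMem_tsupport fun h => h2 (hu h)
    refine hgε.not_ge ?_
    calc eLpNorm f 2 (m.restrict Uᶜ) = eLpNorm (⇑f - ⇑g) 2 (m.restrict Uᶜ) :=
          eLpNorm_congr_ae (by filter_upwards [hg0] with y hy; simp [hy])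
      _ ≤ eLpNorm (⇑f - ⇑g) 2 m := eLpNorm_mono_measure _ Measure.restrict_le_self
      _ = ‖f - g‖ₑ := Lp.enorm_sub_eq.symm
      _ = (‖f - g‖ₑ ^ 2) ^ (1 / 2 : ℝ) := by
          rw [← ENNReal.rpow_natCast, ← ENNReal.rpow_mul]; norm_num
      _ ≤ sobolevNorm m (f - g) := by
          unfold sobolevNorm; gcongr; exact le_self_add
  rw [eLpNorm_eq_zero_iff (Lp.aestronglyMeasurable f).restrict (by norm_num)] at h0
  exact (ae_restrict_iff' hU.compl).1 h0

/-! ### Right continuity in the radius -/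

/-- The infimum of `l ‖v - h‖² + Ch(v)` over compactly supported Lipschitz functions `v` in the
ball of radius `R`. -/
noncomputable def penalizedEnergy (m : Measure X) (x : X) (l : ℕ) (h : Lp ℝ 2 m) (R : ℝ) : ℝ≥0∞ :=
  ⨅ v ∈ lipCompact m (ball x R), l * ‖v - h‖ₑ ^ 2 + cheeger m v

lemma penalizedEnergy_antitone (x : X) (l : ℕ) (h : Lp ℝ 2 m) :
    Antitone (penalizedEnergy m x l h) := fun _ _ hR =>
  biInf_mono fun _ hv => lipCompact_mono (ball_subset_ball hR) hv

/-- Allows replacing an arbitrary `f` by a nearby element of a dense set, with constants independent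
of `l`. -/
lemma penalizedEnergy_le_of_close (x : X) {l : ℕ} {f h : Lp ℝ 2 m} (hfh : l * ‖f - h‖ₑ ^ 2 ≤ 1)
    (R : ℝ) : penalizedEnergy m x l h R ≤ 4 * penalizedEnergy m x l f R + 4 := by
  unfold penalizedEnergy
  simp only [ENNReal.mul_iInf_of_ne (a := 4) (by norm_num) (by norm_num), ENNReal.iInf_add]
  refine iInf₂_mono fun v _ => ?_
  have : ‖v - h‖ₑ ≤ ‖v - f‖ₑ + ‖f - h‖ₑ := by
    rw [← sub_add_sub_cancel v f h]; exact enorm_add_le _ _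
  calc l * ‖v - h‖ₑ ^ 2 + cheeger m v
      ≤ l * (4 * (‖v - f‖ₑ ^ 2 + ‖f - h‖ₑ ^ 2)) + 4 * cheeger m v := by
        gcongr
        · exact (pow_le_pow_left' this 2).trans (add_sq_le_four_mul _ _)
        · exact le_mul_of_one_le_left zero_le (by norm_num)
    _ = 4 * (l * ‖v - f‖ₑ ^ 2 + cheeger m v) + 4 * (l * ‖f - h‖ₑ ^ 2) := by ring
    _ ≤ 4 * (l * ‖v - f‖ₑ ^ 2 + cheeger m v) + 4 * 1 := by gcongr
    _ = _ := by rw [mul_one]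

lemma penalizedEnergy_le_of_mem_H12Zero (H : InfinitesimallyHilbertian m) (x : X) (l : ℕ)
    {f : Lp ℝ 2 m} {R : ℝ} (hf : f ∈ H12Zero m (ball x R)) :
    penalizedEnergy m x l f R ≤ 2 * cheeger m f + 1 := by
  -- This accuracy absorbs the weight `l`, so the resulting bound does not depend on `l`.
  obtain ⟨v, hv, hlt⟩ := hf.2 (((l : ℝ≥0∞) + 1)⁻¹ ^ (1 / 2 : ℝ))
    (ENNReal.rpow_pos_of_nonneg (by simp) (by norm_num))
  unfold sobolevNorm at hlt
  rw [ENNReal.rpow_lt_rpow_iff (by norm_num)] at hlt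
  refine (iInf₂_le v hv).trans ?_
  have h1 : cheeger m v ≤ 2 * cheeger m f + 2 * cheeger m (f - v) := by
    simpa using H.cheeger_sub_le f (f - v)
  calc l * ‖v - f‖ₑ ^ 2 + cheeger m v
      ≤ l * ‖f - v‖ₑ ^ 2 + (2 * cheeger m f + 2 * cheeger m (f - v)) := by
        rw [← enorm_neg, neg_sub]; gcongr
    _ = 2 * cheeger m f + (l * ‖f - v‖ₑ ^ 2 + 1 * (2 * cheeger m (f - v))) := by ring
    _ ≤ 2 * cheeger m f + ((l + 1) * ‖f - v‖ₑ ^ 2 + (l + 1) * (2 * cheeger m (f - v))) := by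
        gcongr
        · exact le_self_add
        · exact le_add_self
    _ = 2 * cheeger m f + (l + 1) * (‖f - v‖ₑ ^ 2 + 2 * cheeger m (f - v)) := by ring
    _ ≤ 2 * cheeger m f + (l + 1) * ((l : ℝ≥0∞) + 1)⁻¹ := by gcongr
    _ ≤ _ := by gcongr; exact ENNReal.mul_inv_le_one _

lemma mem_H12Zero_of_continuousAt (H : InfinitesimallyHilbertian m) (x : X) {R : ℝ}
    {D : Set (Lp ℝ 2 m)} (hD : Dense D)
    (hcont : ∀ l : ℕ, ∀ h ∈ D, ContinuousAt (penalizedEnergy m x l h) R) {f : Lp ℝ 2 m}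
    (hf : ∀ R' > R, f ∈ H12Zero m (ball x R')) : f ∈ H12Zero m (ball x R) := by
  have hft : cheeger m f < ⊤ := (hf (R + 1) (by linarith)).1
  -- Two uses of `penalizedEnergy_le_of_close`: from `f` to `h` at radii `R' > R`, then back to `f`
  -- at `R`.
  set M := 4 * (4 * (2 * cheeger m f + 1) + 4) + 4 with hM
  have hMt : M ≠ ⊤ := by finiteness
  have hbound : ∀ l : ℕ, penalizedEnergy m x l f R ≤ M := by
    intro l
    obtain ⟨h, hhD, hh⟩ : ∃ h ∈ D, l * ‖f - h‖ₑ ^ 2 ≤ 1 := by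
      have hopen : IsOpen {h : Lp ℝ 2 m | (l : ℝ) * ‖f - h‖ ^ 2 < 1} :=
        isOpen_lt (by fun_prop) continuous_const
      obtain ⟨h, h1, h2⟩ := hD.exists_mem_open hopen ⟨f, by simp⟩
      refine ⟨h, h1, ?_⟩
      have : (l : ℝ≥0∞) * ‖f - h‖ₑ ^ 2 = ENNReal.ofReal (l * ‖f - h‖ ^ 2) := by
        rw [ENNReal.ofReal_mul (by positivity), ENNReal.ofReal_pow (norm_nonneg _),
          ofReal_norm, ENNReal.ofReal_natCast]
      rw [this]
      exact ENNReal.ofReal_le_one.2 (le_of_lt h2)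
    have hR : penalizedEnergy m x l h R ≤ 4 * (2 * cheeger m f + 1) + 4 := by
      have hlim : Tendsto (penalizedEnergy m x l h) (𝓝[>] R) (𝓝 (penalizedEnergy m x l h R)) :=
        (hcont l h hhD).tendsto.mono_left nhdsWithin_le_nhds
      refine le_of_tendsto hlim ?_
      filter_upwards [self_mem_nhdsWithin] with R' hR'
      refine (penalizedEnergy_le_of_close x hh R').trans ?_
      gcongr
      exact penalizedEnergy_le_of_mem_H12Zero H x l (hf R' hR')
    refine (penalizedEnergy_le_of_close x (h := f) (f := h) ?_ R).trans ?_
    · rwa [← enorm_neg, neg_sub]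
    · rw [hM]; gcongr
  refine mem_H12Zero_of_forall_exists H (C := M + 1) (by finiteness) fun δ hδ => ?_
  -- A weight this large forces any competitor of penalized energy below `M + 1` to be within `δ` of
  -- `f`.
  obtain ⟨l, hl⟩ := ENNReal.exists_nat_gt (r := (M + 1) / δ ^ 2)
    (ENNReal.div_ne_top (by finiteness) (by positivity))
  obtain ⟨v, hv, hlt⟩ := by
    have := (hbound l).trans_lt (ENNReal.lt_add_right hMt one_ne_zero)
    simpa only [penalizedEnergy, iInf_lt_iff, exists_prop] using this
  refine ⟨v, hv, ?_, le_add_self.trans hlt.le⟩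
  by_contra! hcon
  have hδt : δ ≠ ⊤ := hcon.ne_top
  have h1 : M + 1 ≤ l * δ ^ 2 :=
    (ENNReal.div_le_iff (by positivity) (by finiteness)).1 hl.le
  have h2 : (l : ℝ≥0∞) * δ ^ 2 ≤ l * ‖v - f‖ₑ ^ 2 := by gcongr
  exact (hlt.trans_le (h1.trans h2)).not_ge le_self_add

end Cheeger

end RCDSpace

theorem lemma2p9 {X : Type*} [MetricSpace X] [CompleteSpace X]
    [TopologicalSpace.SeparableSpace X] [MeasurableSpace X] [BorelSpace X]
    (m : Measure X) (K N : ℝ) (hN : 1 ≤ N) (hX : RCDSpace.IsRCDStar K N m) (x : X) :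
    (∀ R : ℝ, 0 < R →
      RCDSpace.H12Hat m (ball x R) =
        ⋂ (ε : ℝ) (_ : 0 < ε), RCDSpace.H12Zero m (ball x (R + ε))) ∧
    {R : ℝ | 0 < R ∧
      RCDSpace.H12Hat m (ball x R) ≠ RCDSpace.H12Zero m (ball x R)}.Countable := by
  have hproper := hX.properSpace hN
  have hsigma := hX.sigmaFinite
  have hsecond := UniformSpace.secondCountable_of_separable X
  have H := hX.hilbertian
  refine ⟨fun R hR => ?_, ?_⟩
  · refine Subset.antisymm (subset_iInter₂ fun ε hε =>
      RCDSpace.H12Hat_ball_subset_H12Zero H x R hε) fun f hf => ?_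
    rw [mem_iInter₂] at hf
    refine ⟨(hf 1 one_pos).1, ?_⟩
    have hsphere : ∀ᵐ y ∂m, y ∉ sphere x R :=
      measure_eq_zero_iff_ae_notMem.1 (hX.measure_sphere hN x hR)
    have hball : ∀ᵐ y ∂m, ∀ n : ℕ, y ∉ ball x (R + 1 / ((n : ℝ) + 1)) → f y = 0 :=
      ae_all_iff.2 fun n =>
        (RCDSpace.H12Zero_subset_H12Hat measurableSet_ball (hf _ (by positivity))).2
    filter_upwards [hsphere, hball] with y h1 h2 hy
    rw [mem_ball, not_lt] at hy
    have hlt : R < dist y x := lt_of_le_of_ne hy fun h => h1 h.symm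
    obtain ⟨n, hn⟩ := exists_nat_one_div_lt (sub_pos.2 hlt)
    exact h2 n (by rw [mem_ball, not_lt]; linarith)
  -- The finite exponent is needed for `L²` to be separable, hence for `denseSeq`.
  · have : Fact ((2 : ℝ≥0∞) ≠ ⊤) := ⟨by norm_num⟩
    set h := TopologicalSpace.denseSeq (Lp ℝ 2 m)
    refine (countable_iUnion fun l : ℕ => countable_iUnion fun k : ℕ =>
      (RCDSpace.penalizedEnergy_antitone x l (h k)).countable_not_continuousAt).mono ?_
    rintro R ⟨_, hne⟩
    by_contra hcon
    simp only [mem_iUnion, mem_ofPred_eq, not_exists, not_not] at hcon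
    refine hne (Subset.antisymm (fun f hf => ?_)
      (RCDSpace.H12Zero_subset_H12Hat measurableSet_ball))
    refine RCDSpace.mem_H12Zero_of_continuousAt H x
      (TopologicalSpace.denseRange_denseSeq (Lp ℝ 2 m)) ?_ fun R' hR' => ?_
    · rintro l _ ⟨k, rfl⟩
      exact hcon l k
    · simpa using RCDSpace.H12Hat_ball_subset_H12Zero H x R (sub_pos.2 hR') hf
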